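/- For $k\ge 1$ let $p_k=\sum_{i} x_i^k$ be the power sum symmetric function in countably many variables, and for a partition $\lambda$ with parts $\lambda_1,\lambda_2,\dots$ put $p_\lambda=\prod_i p_{\lambda_i}$ (with $p_\emptyset=1$). For a finite-dimensional complex representation $V$ of the symmetric group $S_n$ with character $\chi_V$, the Frobenius characteristic is $\mathrm{ch}(V)=\frac1{n!}\sum_{w\in S_n}\chi_V(w)\,p_{\mathrm{type}(w)}$, where $\mathrm{type}(w)\vdash n$ is the cycle type of $w$ (fixed points included). Call $V$ self-conjugate if $V\cong V\otimes\mathrm{sgn}$. Let $q$ be a prime and $n\ge 0$. Then: 1. There is a representation $V$ of $S_n$ of dimension $n!$ with $$\mathrm{ch}(V)=\sum_{\substack{\lambda\vdash n\\ \text{all parts of }\lambda\text{ are powers of }q}}p_\lambda ,$$ where $1=q^0$ counts as a power of $q$. If $q$ is odd, then this representation $V$ is self-conjugate. 2. There is a representation of $S_n$ of dimension $n!$ with Frobenius characteristic $$\sum_{\substack{\lambda\vdash n\\ (\lambda_i,q)=1\text{ for all }i}}p_\lambda .$$ 3. If $q$ is odd, there is a representation of $S_n$ of dimension $n!$ with Frobenius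 characteristic $$\sum_{\substack{\lambda\vdash n,\ \lambda_i\text{ odd}\\ (\lambda_i,q)=1\text{ for all }i}}p_\lambda .$$ -/

import Mathlib

open scoped Nat TensorProduct

/-- The power sum symmetric function `p_k = ∑ i, x_i ^ k` (`k ≥ 1`) in countably many variables
`x_0, x_1, x_2, …`. The ring of symmetric functions with complex coefficients is the ring of
symmetric power series of bounded degree, a subring of `MvPowerSeries ℕ ℂ`. -/
noncomputable def powerSum (k : ℕ) : MvPowerSeries ℕ ℂ :=
  open Classical in fun m => if ∃ i : ℕ, m = Finsupp.single i k then 1 else 0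

/-- `p_lam = ∏ i, p_{lam_i}`, the product over the parts of the partition `lam`;
it equals `1` for the empty partition of `0`. -/
noncomputable def powerSumPart {n : ℕ} (lam : n.Partition) : MvPowerSeries ℕ ℂ :=
  (lam.parts.map powerSum).prod

/-- The Frobenius characteristic of a complex representation `ρ` of `S_n` with character `χ`:
`ch ρ = (1 / n!) ∑_{w ∈ S_n} χ(w) p_{type(w)}`, with `type(w)` the cycle type of `w` (fixed points
counted as parts equal to `1`). -/
noncomputable def frobeniusChar {n : ℕ} {V : Type*} [AddCommGroup V] [Module ℂ V]
    (ρ : Representation ℂ (Equiv.Perm (Fin n)) V) : MvPowerSeries ℕ ℂ :=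
  ((n ! : ℕ) : ℂ)⁻¹ •
    ∑ w : Equiv.Perm (Fin n), ρ.character w • powerSumPart w.partition

/-- The one-dimensional sign representation of `S_n`. -/
noncomputable def signRep (n : ℕ) : Representation ℂ (Equiv.Perm (Fin n)) ℂ where
  toFun w := ((Equiv.Perm.sign w : ℤ) : ℂ) • LinearMap.id
  map_one' := by ext; simp
  map_mul' w w' := by ext; simp [mul_comm]

/-- A representation of `S_n` is self-conjugate if it is isomorphic to its tensor product with the
sign representation. -/
def IsSelfConjugate {n : ℕ} {V : Type*} [AddCommGroup V] [Module ℂ V]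
    (ρ : Representation ℂ (Equiv.Perm (Fin n)) V) : Prop :=
  Nonempty (ρ.Equiv (ρ.tprod (signRep n)))

open Classical in
/-- The multiplicity-free sum of the power sums `p_lam` over the partitions `lam` of `n` all of
whose parts satisfy `P`. -/
noncomputable def powerSumSum (n : ℕ) (P : ℕ → Prop) : MvPowerSeries ℕ ℂ :=
  ∑ lam : n.Partition with ∀ i ∈ lam.parts, P i, powerSumPart lam

/-! It suffices to realise, for each `r`, the class function equal to |C(g)| when g^r = 1 and to 0
otherwise. Since |C(g)| summed over one cycle type is n!, its Frobenius characteristic is the sum of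
p_λ over the λ whose parts all divide `r`. A power of `q`, or a divisor of n! prime to `q` (and to
2), then gives each case.

The representation is conjugation on functions on S_n, twisted by the `r`-th power of a cocycle c(g,
w) (`conjCocycle`). On the centralizer of `w`, a product of wreath products of cyclic groups C_k
with symmetric groups, c(·, w) multiplies a faithful character over the C_k-coordinates. The trace
at `g` is the sum of c(g, w)^r over `w` commuting with `g`. If g^r = 1, each term is c(g^r, w) = 1.
Otherwise some cycle `z` of `g` has length `d` not dividing `r`; along w, wz, ..., wz^(d-1) the
cocycle is a constant times each d-th root of unity once
(`Commute.exists_conjCocycle_mul_cycleOf_pow`, `natCast_eq_of_mul_gcd_eq`), so the `r`-th powers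
cancel.

For odd `r` the character vanishes on odd permutations, so twisting by the sign does not change it,
and the character determines the representation. -/

open Equiv Function

/-! ### Characters determine complex representations -/

/-- Two finite-dimensional semisimple modules receiving the same amount of maps from every simple
module are isomorphic. -/
theorem nonempty_linearEquiv_of_finrank_hom_eq {k A : Type} [Field k] [Ring A] [Algebra k A] (d : ℕ) :
    ∀ (M N : Type) [AddCommGroup M] [AddCommGroup N] [Module k M] [Module k N] [Module A M]
      [Module A N] [IsScalarTower k A M] [IsScalarTower k A N] [FiniteDimensional k M]
      [FiniteDimensional k N] [IsSemisimpleModule A M] [IsSemisimpleModule A N],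
      Module.finrank k M = d →
      (∀ (S : Type) [AddCommGroup S] [Module k S] [Module A S] [IsScalarTower k A S]
        [FiniteDimensional k S] [IsSimpleModule A S],
        Module.finrank k (S →ₗ[A] M) = Module.finrank k (S →ₗ[A] N)) →
      Nonempty (M ≃ₗ[A] N) := by
  induction d using Nat.strong_induction_on with
  | _ d ih =>
  intro M N _ _ _ _ _ _ _ _ _ _ _ _ hd h
  have finHom : ∀ (S T : Type) [AddCommGroup S] [AddCommGroup T] [Module k S] [Module k T]
      [Module A S] [Module A T] [IsScalarTower k A S] [IsScalarTower k A T]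
      [FiniteDimensional k S] [FiniteDimensional k T], FiniteDimensional k (S →ₗ[A] T) := by
    intro S T _ _ _ _ _ _ _ _ _ _
    let F : (S →ₗ[A] T) →ₗ[k] (S →ₗ[k] T) :=
      { toFun := fun f => f.restrictScalars k
        map_add' := fun _ _ => rfl
        map_smul' := fun _ _ => rfl }
    exact FiniteDimensional.of_injective F (LinearMap.restrictScalars_injective k)
  rcases subsingleton_or_nontrivial M with hM | hM
  · rcases subsingleton_or_nontrivial N with hN | hN
    · exact ⟨LinearEquiv.ofSubsingleton M N⟩
    · obtain ⟨S, hS⟩ := IsSemisimpleModule.exists_simple_submodule A N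
      have : FiniteDimensional k S := FiniteDimensional.finiteDimensional_submodule (S.restrictScalars k)
      have h1 := h S
      have : FiniteDimensional k (S →ₗ[A] N) := finHom _ _
      rw [Module.finrank_zero_of_subsingleton, eq_comm, Module.finrank_zero_iff] at h1
      have h2 : S.subtype = 0 := Subsingleton.elim _ _
      have := IsSimpleModule.nontrivial A S
      obtain ⟨x, hx⟩ := exists_ne (0 : S)
      exact (hx (Subtype.ext (congrArg (fun f => f x) h2))).elim
  · obtain ⟨S, hS⟩ := IsSemisimpleModule.exists_simple_submodule A M
    have : FiniteDimensional k S := FiniteDimensional.finiteDimensional_submodule (S.restrictScalars k)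
    have hSn := IsSimpleModule.nontrivial A S
    obtain ⟨f, hf⟩ : ∃ f : S →ₗ[A] N, f ≠ 0 := by
      have h1 := h S
      have : FiniteDimensional k (S →ₗ[A] M) := finHom _ _
      by_contra! hc
      have : Subsingleton (S →ₗ[A] N) := ⟨fun a b => by rw [hc a, hc b]⟩
      rw [Module.finrank_zero_of_subsingleton (M := S →ₗ[A] N), Module.finrank_zero_iff] at h1
      have h2 : S.subtype = 0 := Subsingleton.elim _ _
      obtain ⟨x, hx⟩ := exists_ne (0 : S)
      exact hx (Subtype.ext (congrArg (fun f => f x) h2))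
    have hfi : Function.Injective f := (LinearMap.injective_or_eq_zero f).resolve_right hf
    obtain ⟨C, hC⟩ := exists_isCompl S
    obtain ⟨C', hC'⟩ := exists_isCompl (LinearMap.range f)
    have : FiniteDimensional k C := FiniteDimensional.finiteDimensional_submodule (C.restrictScalars k)
    have : FiniteDimensional k C' := FiniteDimensional.finiteDimensional_submodule (C'.restrictScalars k)
    let e : (S × C) ≃ₗ[A] M := Submodule.prodEquivOfIsCompl S C hC
    let e' : (S × C') ≃ₗ[A] N := ((LinearEquiv.ofInjective f hfi).prodCongr (LinearEquiv.refl A C')).trans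
      (Submodule.prodEquivOfIsCompl _ C' hC')
    -- Additivity of Hom dimensions lets the common summand `S` be cancelled, so the induction
    -- applies to the complements.
    have key : ∀ (T D P : Type) [AddCommGroup T] [Module k T] [Module A T] [IsScalarTower k A T]
        [FiniteDimensional k T] [AddCommGroup D] [Module k D] [Module A D] [IsScalarTower k A D]
        [FiniteDimensional k D] [AddCommGroup P] [Module k P] [Module A P] [IsScalarTower k A P]
        (_ : (S × D) ≃ₗ[A] P), Module.finrank k (T →ₗ[A] P) =
          Module.finrank k (T →ₗ[A] S) + Module.finrank k (T →ₗ[A] D) := by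
      intro T D P _ _ _ _ _ _ _ _ _ _ _ _ _ _ ε
      have := finHom T S
      have := finHom T D
      rw [← Module.finrank_prod]
      let F : ((T →ₗ[A] S) × (T →ₗ[A] D)) ≃ₗ[k] (T →ₗ[A] P) :=
        { toFun := fun p => ε.toLinearMap ∘ₗ (p.1.prod p.2)
          map_add' := fun p q => by ext t; simp [← map_add]
          map_smul' := fun c p => by
            ext t
            have := (ε.toLinearMap.restrictScalars k).map_smul c (p.1 t, p.2 t)
            simpa using this
          invFun := fun g => (LinearMap.fst A S D ∘ₗ ε.symm.toLinearMap ∘ₗ g,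
            LinearMap.snd A S D ∘ₗ ε.symm.toLinearMap ∘ₗ g)
          left_inv := fun p => by ext <;> simp
          right_inv := fun g => by ext t; simp }
      exact F.finrank_eq.symm
    have hdim : Module.finrank k C < d := by
      rw [← hd, ← (e.restrictScalars k).finrank_eq, Module.finrank_prod]
      have : 0 < Module.finrank k S := Module.finrank_pos
      omega
    obtain ⟨ε⟩ := ih _ hdim C C' rfl (fun T _ _ _ _ _ _ => by
      have h1 := h T
      rw [key T C M e, key T C' N e'] at h1
      omega)
    exact ⟨e.symm.trans (((LinearEquiv.refl A S).prodCongr ε).trans e')⟩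

/-- Complex representations of a finite group are determined by their characters. -/
theorem nonempty_equiv_of_character_eq {G V W : Type} [Group G] [Fintype G] [AddCommGroup V]
    [Module ℂ V] [FiniteDimensional ℂ V] [AddCommGroup W] [Module ℂ W] [FiniteDimensional ℂ W]
    (ρ : Representation ℂ G V) (σ : Representation ℂ G W) (h : ρ.character = σ.character) :
    Nonempty (ρ.Equiv σ) := by
  have hG : (Nat.card G : ℂ) ≠ 0 := Nat.cast_ne_zero.2 Nat.card_pos.ne'
  have : NeZero (Nat.card G : ℂ) := ⟨hG⟩
  have : Invertible (Nat.card G : ℂ) := invertibleOfNonzero hG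
  have : FiniteDimensional ℂ ρ.asModule := inferInstanceAs (FiniteDimensional ℂ V)
  have : FiniteDimensional ℂ σ.asModule := inferInstanceAs (FiniteDimensional ℂ W)
  have key : ∀ (S U : Type) [AddCommGroup S] [Module ℂ S] [Module (MonoidAlgebra ℂ G) S]
      [IsScalarTower ℂ (MonoidAlgebra ℂ G) S] [FiniteDimensional ℂ S] [AddCommGroup U] [Module ℂ U]
      [FiniteDimensional ℂ U] (τ : Representation ℂ G U),
      (Module.finrank ℂ (S →ₗ[MonoidAlgebra ℂ G] τ.asModule) : ℂ) =
        (Nat.card G : ℂ)⁻¹ * ∑ g : G, τ.character g *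
          (Representation.ofModule' (k := ℂ) (G := G) S).character g⁻¹ := by
    intro S U _ _ _ _ _ _ _ _ τ
    rw [Representation.card_inv_mul_sum_char_mul_char_eq_finrank]
    have e : (Representation.ofModule' (k := ℂ) (G := G) S).asModule ≃ₗ[MonoidAlgebra ℂ G] S :=
      { (Representation.ofModule' (k := ℂ) (G := G) S).asModuleEquiv with
        map_smul' := fun a x => by
          induction a using MonoidAlgebra.induction_linear with
          | zero => simp
          | add a b ha hb => simp_all [add_smul]
          | single g a =>
            have h1 : (MonoidAlgebra.single g a : MonoidAlgebra ℂ G) = a • MonoidAlgebra.single g 1 := by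
              simp
            rw [Representation.single_smul, h1]
            exact (smul_assoc a (MonoidAlgebra.single g 1 : MonoidAlgebra ℂ G) (show S from x)).symm }
    let E := (Representation.IntertwiningMap.equivLinearMapAsModule
      (Representation.ofModule' (k := ℂ) (G := G) S) τ)
    let F : (S →ₗ[MonoidAlgebra ℂ G] τ.asModule) ≃ₗ[ℂ]
        ((Representation.ofModule' (k := ℂ) (G := G) S).asModule →ₗ[MonoidAlgebra ℂ G] τ.asModule) :=
      { toFun := fun f => f ∘ₗ e.toLinearMap
        map_add' := fun _ _ => rfl
        map_smul' := fun _ _ => rfl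
        invFun := fun f => f ∘ₗ e.symm.toLinearMap
        left_inv := fun f => by ext; simp
        right_inv := fun f => by ext; simp }
    rw [(F.trans E.symm).finrank_eq]
  obtain ⟨e⟩ := nonempty_linearEquiv_of_finrank_hom_eq (k := ℂ) (A := MonoidAlgebra ℂ G) _
    ρ.asModule σ.asModule rfl (fun S _ _ _ _ _ _ => by
      have := key S V ρ
      rw [h, ← key S W σ] at this
      exact_mod_cast this)
  let F := (Representation.IntertwiningMap.equivLinearMapAsModule ρ σ).symm e.toLinearMap
  exact ⟨F.ofBijective e.bijective⟩

/-! ### Cycle lengths as minimal periods, and roots of unity -/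

theorem Equiv.Perm.isPeriodicPt_iff_pow {α : Type*} (w : Perm α) (n : ℕ) (x : α) :
    IsPeriodicPt w n x ↔ (w ^ n) x = x := by
  rw [IsPeriodicPt, IsFixedPt, Perm.iterate_eq_pow]

theorem Equiv.Perm.pow_apply_eq_self_iff_dvd {α : Type*} (w : Perm α) (n : ℕ) (x : α) :
    (w ^ n) x = x ↔ minimalPeriod w x ∣ n := by
  rw [← Perm.isPeriodicPt_iff_pow, isPeriodicPt_iff_minimalPeriod_dvd]

theorem Equiv.Perm.minimalPeriod_pos {α : Type*} [Finite α] (w : Perm α) (x : α) :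
    0 < minimalPeriod w x :=
  IsPeriodicPt.minimalPeriod_pos (orderOf_pos w) (by
    rw [Perm.isPeriodicPt_iff_pow, pow_orderOf_eq_one, Perm.one_apply])

theorem Equiv.Perm.minimalPeriod_congr {α β : Type*} (w : Perm α) (v : Perm β) (x : α) (y : β)
    (h : ∀ n : ℕ, (w ^ n) x = x ↔ (v ^ n) y = y) : minimalPeriod w x = minimalPeriod v y :=
  Nat.dvd_antisymm
    (by rw [← Perm.pow_apply_eq_self_iff_dvd, h, Perm.pow_apply_eq_self_iff_dvd])
    (by rw [← Perm.pow_apply_eq_self_iff_dvd, ← h, Perm.pow_apply_eq_self_iff_dvd])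

theorem Equiv.Perm.pow_apply_eq_pow_apply_iff {α : Type*} (w : Perm α) (i j : ℕ) (x : α) :
    (w ^ i) x = (w ^ j) x ↔ i ≡ j [MOD minimalPeriod w x] := by
  rw [Nat.modEq_iff_dvd]
  refine Iff.trans ?_ (MulAction.zpow_smul_eq_iff_minimalPeriod_dvd (a := w) (b := x))
  rw [sub_eq_neg_add, zpow_add, mul_smul, zpow_neg, inv_smul_eq_iff, eq_comm, zpow_natCast,
    zpow_natCast, Perm.smul_def, Perm.smul_def]

/-- The root of unity `exp (2πi m / k)`. -/
noncomputable def rootExp (m k : ℕ) : ℂ := Complex.exp (2 * Real.pi * Complex.I * (m / k))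

theorem rootExp_add (m m' k : ℕ) : rootExp (m + m') k = rootExp m k * rootExp m' k := by
  rw [rootExp, rootExp, rootExp, ← Complex.exp_add]
  congr 1
  push_cast
  ring

theorem rootExp_ne_zero (m k : ℕ) : rootExp m k ≠ 0 := Complex.exp_ne_zero _

theorem rootExp_mul_left {c : ℕ} (hc : c ≠ 0) (m k : ℕ) : rootExp (c * m) (c * k) = rootExp m k := by
  rw [rootExp, rootExp]
  push_cast
  rw [mul_div_mul_left _ _ (Nat.cast_ne_zero.2 hc)]

theorem rootExp_eq_stdAddChar (m k : ℕ) [NeZero k] :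
    rootExp m k = ZMod.stdAddChar (m : ZMod k) := by
  have := ZMod.stdAddChar_coe (N := k) (m : ℤ)
  rw [Int.cast_natCast] at this
  rw [this, rootExp]
  push_cast
  ring_nf

theorem rootExp_congr {m m' k : ℕ} (hk : 0 < k) (h : m ≡ m' [MOD k]) :
    rootExp m k = rootExp m' k := by
  have : NeZero k := ⟨hk.ne'⟩
  rw [rootExp_eq_stdAddChar, rootExp_eq_stdAddChar, (ZMod.natCast_eq_natCast_iff _ _ _).2 h]

/-! ### The twisting cocycle -/

section Cocycle

variable {α : Type*}

/-- A point of the cycle of `w` through `x`, depending only on that cycle. -/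
noncomputable def cycleBase (w : Perm α) (x : α) : α :=
  @Classical.epsilon α ⟨x⟩ fun y => w.SameCycle x y

theorem sameCycle_cycleBase (w : Perm α) (x : α) : w.SameCycle x (cycleBase w x) :=
  @Classical.epsilon_spec α (fun y => w.SameCycle x y) ⟨x, Perm.SameCycle.rfl⟩

theorem cycleBase_congr {w v : Perm α} {x y : α} (h : ∀ z, w.SameCycle x z ↔ v.SameCycle y z) :
    cycleBase w x = cycleBase v y := by
  have h' : (fun z => w.SameCycle x z) = fun z => v.SameCycle y z := funext fun z => propext (h z)
  rw [cycleBase, cycleBase, h']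

theorem Equiv.Perm.SameCycle.cycleBase_eq {w : Perm α} {x y : α} (h : w.SameCycle x y) :
    cycleBase w x = cycleBase w y :=
  cycleBase_congr fun _ => ⟨h.symm.trans, h.trans⟩

theorem cycleBase_cycleBase (w : Perm α) (x : α) : cycleBase w (cycleBase w x) = cycleBase w x :=
  (sameCycle_cycleBase w x).symm.cycleBase_eq

/-- If `y = w ^ i x` and the cycle of `x` has length `k`, this is `exp (2πi i / k)`. -/
noncomputable def cyclePhase (w : Perm α) (x y : α) : ℂ :=
  rootExp (Classical.epsilon fun i : ℕ => (w ^ i) x = y) (minimalPeriod w x)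

variable [Fintype α]

/-- The chosen exponent is immaterial: two exponents reaching the same point agree modulo the cycle
length. -/
theorem cyclePhase_pow_apply (w : Perm α) (x : α) (i : ℕ) :
    cyclePhase w x ((w ^ i) x) = rootExp i (minimalPeriod w x) :=
  rootExp_congr (w.minimalPeriod_pos x) ((w.pow_apply_eq_pow_apply_iff _ _ x).1
    (Classical.epsilon_spec (p := fun j : ℕ => (w ^ j) x = (w ^ i) x) ⟨i, rfl⟩))

omit [Fintype α] in
theorem cyclePhase_ne_zero (w : Perm α) (x y : α) : cyclePhase w x y ≠ 0 := rootExp_ne_zero _ _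

omit [Fintype α] in
theorem Equiv.Perm.minimalPeriod_pow_apply [Finite α] (w : Perm α) (x : α) (i : ℕ) :
    minimalPeriod w ((w ^ i) x) = minimalPeriod w x :=
  Perm.minimalPeriod_congr _ _ _ _ fun n => by
    rw [← Perm.mul_apply, ← pow_add, add_comm, pow_add, Perm.mul_apply, (w ^ i).injective.eq_iff]

theorem cyclePhase_mul {w : Perm α} {x y z : α} (hy : w.SameCycle x y) (hz : w.SameCycle y z) :
    cyclePhase w x y * cyclePhase w y z = cyclePhase w x z := by
  obtain ⟨i, rfl⟩ := hy.exists_nat_pow_eq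
  obtain ⟨j, rfl⟩ := hz.exists_nat_pow_eq
  rw [cyclePhase_pow_apply, cyclePhase_pow_apply, w.minimalPeriod_pow_apply, ← rootExp_add,
    ← Perm.mul_apply, ← pow_add, cyclePhase_pow_apply, add_comm]

theorem conj_pow_apply_eq_iff {α : Type*} (g w : Perm α) (n : ℕ) (x y : α) :
    ((g * w * g⁻¹) ^ n) (g x) = g y ↔ (w ^ n) x = y := by
  simp [conj_pow]

omit [Fintype α] in
theorem cyclePhase_conj (g w : Perm α) (x y : α) :
    cyclePhase (g * w * g⁻¹) (g x) (g y) = cyclePhase w x y := by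
  simp only [cyclePhase, conj_pow_apply_eq_iff]
  rw [Perm.minimalPeriod_congr _ _ _ _ fun n => conj_pow_apply_eq_iff g w n x x]

/-- The phase of a point relative to the base point of its cycle. -/
noncomputable def basePhase (w : Perm α) (x : α) : ℂ := cyclePhase w (cycleBase w x) x

omit [Fintype α] in
theorem basePhase_ne_zero (w : Perm α) (x : α) : basePhase w x ≠ 0 := cyclePhase_ne_zero _ _ _

theorem basePhase_mul_cyclePhase {w : Perm α} {x y : α} (h : w.SameCycle x y) :
    basePhase w x * cyclePhase w x y = basePhase w y := by
  rw [basePhase, basePhase, ← h.cycleBase_eq,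
    cyclePhase_mul (sameCycle_cycleBase w x).symm h]

open Classical in
/-- The base points of all cycles. -/
noncomputable def cycleBases (w : Perm α) : Finset α := {t | cycleBase w t = t}

/-- The change of phase under `g`, from `w` to its conjugate by `g`. -/
noncomputable def phaseRatio (g w : Perm α) (x : α) : ℂ :=
  basePhase (g * w * g⁻¹) (g x) / basePhase w x

/-- Moving along the cycle multiplies numerator and denominator by the same phase, because
conjugation preserves relative phases. -/
theorem Equiv.Perm.SameCycle.phaseRatio_eq (g : Perm α) {w : Perm α} {x y : α}
    (h : w.SameCycle x y) : phaseRatio g w x = phaseRatio g w y := by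
  rw [phaseRatio, phaseRatio, ← basePhase_mul_cyclePhase h, ← basePhase_mul_cyclePhase h.conj,
    cyclePhase_conj, mul_div_mul_right _ _ (cyclePhase_ne_zero _ _ _)]

omit [Fintype α] in
theorem phaseRatio_mul (g h w : Perm α) (x : α) :
    phaseRatio (g * h) w x = phaseRatio g (h * w * h⁻¹) (h x) * phaseRatio h w x := by
  rw [phaseRatio, phaseRatio, phaseRatio, div_mul_div_cancel₀ (basePhase_ne_zero _ _)]
  simp [mul_assoc]

/-- A set of representatives of the cycles of `w`. -/
structure IsCycleTransversal (w : Perm α) (T : Finset α) : Prop where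
  exists_mem : ∀ x, ∃ t ∈ T, w.SameCycle x t
  eq_of_sameCycle : ∀ s ∈ T, ∀ t ∈ T, w.SameCycle s t → s = t

theorem isCycleTransversal_cycleBases (w : Perm α) : IsCycleTransversal w (cycleBases w) where
  exists_mem x := ⟨cycleBase w x, by simp [cycleBases, cycleBase_cycleBase],
    sameCycle_cycleBase w x⟩
  eq_of_sameCycle s hs t ht h := by
    simp only [cycleBases, Finset.mem_filter, Finset.mem_univ, true_and] at hs ht
    rw [← hs, ← ht, h.cycleBase_eq]

omit [Fintype α] in
theorem IsCycleTransversal.prod_eq {w : Perm α} {S T : Finset α} (hS : IsCycleTransversal w S)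
    (hT : IsCycleTransversal w T) (f : α → ℂ) (hf : ∀ x y, w.SameCycle x y → f x = f y) :
    ∏ t ∈ S, f t = ∏ t ∈ T, f t := by
  choose i hi hi' using hT.exists_mem
  refine Finset.prod_bij (fun x _ => i x) (fun x _ => hi x) (fun x hx y hy h => ?_)
    (fun t ht => ?_) (fun x _ => hf _ _ (hi' x))
  · exact hS.eq_of_sameCycle x hx y hy ((hi' x).trans (h ▸ (hi' y).symm))
  · obtain ⟨s, hs, hts⟩ := hS.exists_mem t
    exact ⟨s, hs, (hT.eq_of_sameCycle _ ht _ (hi s) (hts.trans (hi' s))).symm⟩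

/-- The cocycle by which the conjugation action of the symmetric group on itself is twisted. -/
noncomputable def conjCocycle (g w : Perm α) : ℂ := ∏ t ∈ cycleBases w, phaseRatio g w t

/-- This frees the cocycle from the chosen base points, so it can be computed on a transversal
adapted to `g`. -/
theorem IsCycleTransversal.conjCocycle_eq {w : Perm α} {T : Finset α}
    (hT : IsCycleTransversal w T) (g : Perm α) : conjCocycle g w = ∏ t ∈ T, phaseRatio g w t :=
  (isCycleTransversal_cycleBases w).prod_eq hT _ fun _ _ h => h.phaseRatio_eq g

omit [Fintype α] in
theorem IsCycleTransversal.conj {w : Perm α} {T : Finset α} (hT : IsCycleTransversal w T)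
    (g : Perm α) : IsCycleTransversal (g * w * g⁻¹) (T.map g.toEmbedding) where
  exists_mem x := by
    obtain ⟨t, ht, h⟩ := hT.exists_mem (g⁻¹ x)
    exact ⟨g t, Finset.mem_map_of_mem _ ht, by simpa using h.conj (g := g)⟩
  eq_of_sameCycle s hs t ht h := by
    rw [Finset.mem_map] at hs ht
    obtain ⟨s, hs, rfl⟩ := hs
    obtain ⟨t, ht, rfl⟩ := ht
    rw [hT.eq_of_sameCycle s hs t ht (by simpa [Perm.sameCycle_conj] using h)]

theorem conjCocycle_mul (g h w : Perm α) :
    conjCocycle (g * h) w = conjCocycle g (h * w * h⁻¹) * conjCocycle h w := by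
  rw [((isCycleTransversal_cycleBases w).conj h).conjCocycle_eq, Finset.prod_map, conjCocycle,
    conjCocycle, ← Finset.prod_mul_distrib]
  exact Finset.prod_congr rfl fun t _ => phaseRatio_mul g h w t

theorem conjCocycle_one (w : Perm α) : conjCocycle 1 w = 1 :=
  Finset.prod_eq_one fun t _ => by simp [phaseRatio, basePhase_ne_zero]

/-- On the centralizer of `w` the cocycle identity becomes multiplicativity. -/
theorem conjCocycle_pow {g w : Perm α} (h : Commute g w) (m : ℕ) :
    conjCocycle (g ^ m) w = conjCocycle g w ^ m := by
  induction m with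
  | zero => simp [conjCocycle_one]
  | succ m ih =>
    have : g * w * g⁻¹ = w := by rw [h.eq, mul_inv_cancel_right]
    rw [pow_succ, conjCocycle_mul, this, ih, pow_succ]

/-- Locality: the base point depends only on the cycle as a set, so changing a permutation elsewhere
leaves the phase alone. -/
theorem basePhase_congr {w v : Perm α} {x : α} (h : ∀ m : ℕ, (w ^ m) x = (v ^ m) x) :
    basePhase w x = basePhase v x := by
  have hs : ∀ z, w.SameCycle x z ↔ v.SameCycle x z := fun z =>
    ⟨fun hz => by
      obtain ⟨m, rfl⟩ := hz.exists_nat_pow_eq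
      rw [h]
      exact Perm.SameCycle.rfl.pow_right, fun hz => by
      obtain ⟨m, rfl⟩ := hz.exists_nat_pow_eq
      rw [← h]
      exact Perm.SameCycle.rfl.pow_right⟩
  have hb : cycleBase w x = cycleBase v x := cycleBase_congr hs
  obtain ⟨s, hws⟩ := (sameCycle_cycleBase w x).exists_nat_pow_eq
  have h' : ∀ m : ℕ, (w ^ m) (cycleBase v x) = (v ^ m) (cycleBase v x) := fun m => by
    have hvs : (v ^ s) x = cycleBase v x := by rw [← h, hws, hb]
    rw [← hb, ← hws, ← Perm.mul_apply, ← pow_add, h, pow_add, Perm.mul_apply, hvs, ← hvs, h]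
  rw [basePhase, basePhase, hb, cyclePhase, cyclePhase,
    Perm.minimalPeriod_congr w v _ _ fun n => by rw [h']]
  simp only [h']

end Cocycle

/-! ### Inversion up to the gcd in ℤ/d -/

theorem exists_mul_modEq_gcd {d : ℕ} (hd : 0 < d) (u : ℕ) : ∃ m : ℕ, u * m ≡ u.gcd d [MOD d] := by
  have : NeZero d := ⟨hd.ne'⟩
  refine ⟨((Nat.gcdA u d : ℤ) : ZMod d).val, ?_⟩
  rw [← ZMod.natCast_eq_natCast_iff]
  have h := congrArg (Int.cast : ℤ → ZMod d) (Nat.gcd_eq_gcd_ab u d)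
  push_cast at h
  simp only [CharP.cast_eq_zero, zero_mul, add_zero] at h
  rw [h]
  simp

/-- With j = gcd(u, d) and u = aj, `m` inverts `a` modulo d/j, so u ↦ mj inverts the unit part and
keeps the gcd. Hence it is injective: the value first recovers `j`, then `u`. -/
theorem natCast_eq_of_mul_gcd_eq {d : ℕ} {u m u' m' : ℕ}
    (h : u * m ≡ u.gcd d [MOD d]) (h' : u' * m' ≡ u'.gcd d [MOD d])
    (hv : ((m * u.gcd d : ℕ) : ZMod d) = (m' * u'.gcd d : ℕ)) : (u : ZMod d) = u' := by
  have dvd_aux : ∀ {u m u' m' : ℕ}, u * m ≡ u.gcd d [MOD d] →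
      ((m * u.gcd d : ℕ) : ZMod d) = (m' * u'.gcd d : ℕ) → u'.gcd d ∣ u.gcd d := by
    intro u m u' m' h hv
    obtain ⟨a, ha⟩ := Nat.gcd_dvd_left u d
    have h1 : u.gcd d ≡ a * m' * u'.gcd d [MOD d] := by
      rw [← ZMod.natCast_eq_natCast_iff] at h ⊢
      push_cast at h hv ⊢
      rw [mul_assoc, ← hv, ← h]
      have ha' := congrArg (Nat.cast : ℕ → ZMod d) ha
      push_cast at ha'
      rw [← h] at ha'
      linear_combination (m : ZMod d) * ha'
    exact (h1.dvd_iff (Nat.gcd_dvd_right u' d)).2 (Dvd.intro_left _ rfl)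
  have hj : u.gcd d = u'.gcd d := Nat.dvd_antisymm (dvd_aux h' hv.symm) (dvd_aux h hv)
  obtain ⟨a, ha⟩ := Nat.gcd_dvd_left u d
  obtain ⟨a', ha'⟩ := Nat.gcd_dvd_left u' d
  rw [← hj] at h' hv ha'
  generalize u.gcd d = j at *
  rw [← ZMod.natCast_eq_natCast_iff] at h h'
  have ha := congrArg (Nat.cast : ℕ → ZMod d) ha
  have ha' := congrArg (Nat.cast : ℕ → ZMod d) ha'
  push_cast at h h' hv ha ha'
  have e1 : (u : ZMod d) = a * (u' * m') := by rw [h', ha]; ring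
  have e2 : (u' : ZMod d) = a' * (u * m) := by rw [h, ha']; ring
  calc (u : ZMod d) = a * a' * (m' * j) := by rw [e1, ha']; ring
    _ = a' * (u * m) := by rw [← hv, ha]; ring
    _ = u' := e2.symm

/-- By injectivity the exponents exhaust ℤ/d, leaving the complete sum of a nontrivial additive
character. -/
theorem sum_rootExp_pow_eq_zero {d r : ℕ} (hd : 0 < d) (hr : ¬ d ∣ r) (c : ℕ) (m : ℕ → ℕ)
    (hm : ∀ i, (c + i) * m i ≡ (c + i).gcd d [MOD d]) :
    ∑ i ∈ Finset.range d, rootExp (m i * (c + i).gcd d) d ^ r = 0 := by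
  have : NeZero d := ⟨hd.ne'⟩
  let F : ℕ → ZMod d := fun i => ((m i * (c + i).gcd d : ℕ) : ZMod d)
  have hF : Set.InjOn F (Finset.range d) := by
    intro i hi j hj hij
    have h1 := natCast_eq_of_mul_gcd_eq (hm i) (hm j) hij
    rw [ZMod.natCast_eq_natCast_iff] at h1
    have h2 := Nat.ModEq.add_left_cancel' c h1
    rw [Finset.coe_range, Set.mem_Iio] at hi hj
    exact Nat.ModEq.eq_of_lt_of_lt h2 hi hj
  have himg : (Finset.range d).image F = Finset.univ := by
    rw [← Finset.card_eq_iff_eq_univ, Finset.card_image_of_injOn hF, Finset.card_range, ZMod.card]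
  have hsum : ∑ x : ZMod d, (ZMod.stdAddChar x : ℂ) ^ r = 0 := by
    have := AddChar.sum_mulShift (R := ZMod d) (R' := ℂ) (r : ZMod d)
      (ZMod.isPrimitive_stdAddChar d)
    rw [if_neg (by rwa [ZMod.natCast_eq_zero_iff])] at this
    rw [← Nat.cast_zero, ← this]
    refine Finset.sum_congr rfl fun x _ => ?_
    rw [← AddChar.map_nsmul_eq_pow, nsmul_eq_mul, mul_comm]
  rw [← hsum, ← himg, Finset.sum_image hF]
  exact Finset.sum_congr rfl fun i _ => by rw [rootExp_eq_stdAddChar]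

/-! ### Cycles of a permutation commuting with `g` -/

section CommutingPair

variable {α : Type*} [Fintype α] {g v w ζ : Perm α} {x₀ : α} {b c i u m : ℕ}

omit [Fintype α] in
theorem Commute.pow_apply_pow_apply (h : Commute g w) (i j : ℕ) (x : α) :
    (g ^ i) ((w ^ j) x) = (w ^ j) ((g ^ i) x) := by
  rw [← Perm.mul_apply, (h.pow_pow i j).eq, Perm.mul_apply]

omit [Fintype α] in
theorem Commute.sameCycle_pow (h : Commute g w) {x y : α} (n : ℕ) :
    g.SameCycle ((w ^ n) x) ((w ^ n) y) ↔ g.SameCycle x y := by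
  have e : w ^ n * g * (w ^ n)⁻¹ = g := by
    rw [((h.pow_right n).eq).symm, mul_inv_cancel_right]
  rw [← e, Perm.sameCycle_conj, e]
  simp

/-- `w` permutes the cycles of `g`; `b` is the period of the one through `x₀`. -/
theorem Commute.exists_sameCycle_pow_iff_dvd (h : Commute g w) (x₀ : α) :
    ∃ b : ℕ, 0 < b ∧ ∀ n : ℕ, g.SameCycle x₀ ((w ^ n) x₀) ↔ b ∣ n := by
  classical
  have hex : ∃ b : ℕ, 0 < b ∧ g.SameCycle x₀ ((w ^ b) x₀) :=
    ⟨orderOf w, orderOf_pos w, by rw [pow_orderOf_eq_one]; exact Perm.SameCycle.rfl⟩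
  obtain ⟨hb, hbx⟩ := Nat.find_spec hex
  have hmin := fun k => @Nat.find_min _ _ hex k
  generalize Nat.find hex = b at hb hbx hmin
  have hmul : ∀ q : ℕ, g.SameCycle x₀ ((w ^ (b * q)) x₀) := by
    intro q
    induction q with
    | zero => exact Perm.SameCycle.rfl
    | succ q ih =>
      rw [Nat.mul_succ, add_comm, pow_add, Perm.mul_apply]
      exact hbx.trans ((h.sameCycle_pow b).2 ih)
  refine ⟨b, hb, fun n => ⟨fun hn => ?_, ?_⟩⟩
  · rw [← Nat.mod_add_div n b, pow_add, Perm.mul_apply] at hn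
    have h1 := hn.trans ((h.sameCycle_pow _).2 (hmul (n / b)).symm)
    by_contra hbn
    exact hmin _ (Nat.mod_lt n hb) ⟨Nat.pos_of_ne_zero fun h0 => hbn (Nat.dvd_of_mod_eq_zero h0), h1⟩
  · rintro ⟨q, rfl⟩
    exact hmul q

omit [Fintype α] in
theorem Commute.pow_mul_apply_eq (h : Commute g v) (hu : (v ^ b) x₀ = (g ^ u) x₀) (n : ℕ) :
    (v ^ (b * n)) x₀ = (g ^ (u * n)) x₀ := by
  induction n with
  | zero => simp
  | succ n ih =>
    rw [Nat.mul_succ, add_comm, pow_add, Perm.mul_apply, ih, ← h.pow_apply_pow_apply, hu,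
      ← Perm.mul_apply, ← pow_add, Nat.mul_succ]

/-- The orbit of `x₀` under `v` meets its `g`-cycle only at multiples of `b`, each return being a
rotation by `u`, of order d/gcd(u, d) with d the cycle length. -/
theorem Commute.minimalPeriod_eq (h : Commute g v)
    (hb : ∀ n : ℕ, g.SameCycle x₀ ((v ^ n) x₀) ↔ b ∣ n) (hu : (v ^ b) x₀ = (g ^ u) x₀) :
    minimalPeriod v x₀ = b * (minimalPeriod g x₀ / u.gcd (minimalPeriod g x₀)) := by
  have hd := g.minimalPeriod_pos x₀
  have key : ∀ n : ℕ, (v ^ n) x₀ = x₀ ↔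
      b * (minimalPeriod g x₀ / u.gcd (minimalPeriod g x₀)) ∣ n := by
    intro n
    have hdiv : ∀ n' : ℕ, (g ^ (u * n')) x₀ = x₀ ↔
        minimalPeriod g x₀ / u.gcd (minimalPeriod g x₀) ∣ n' := by
      intro n'
      rw [g.pow_apply_eq_self_iff_dvd]
      exact ⟨fun hn => (Nat.Coprime.dvd_of_dvd_mul_left
        (Nat.coprime_div_gcd_div_gcd (Nat.gcd_pos_of_pos_right u hd)).symm (by
          obtain ⟨a, ha⟩ := Nat.gcd_dvd_left u (minimalPeriod g x₀)
          rw [Nat.div_dvd_iff_dvd_mul (Nat.gcd_dvd_right _ _) (Nat.gcd_pos_of_pos_right u hd),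
            ← mul_assoc, Nat.mul_div_cancel' (Nat.gcd_dvd_left _ _)]
          exact hn)),
        fun hn => by
          rw [Nat.div_dvd_iff_dvd_mul (Nat.gcd_dvd_right _ _)
            (Nat.gcd_pos_of_pos_right u hd)] at hn
          exact hn.trans (Nat.mul_dvd_mul_right (Nat.gcd_dvd_left _ _) _)⟩
    constructor
    · intro hn
      obtain ⟨n', rfl⟩ := (hb n).1 (by rw [hn])
      rw [h.pow_mul_apply_eq hu, hdiv] at hn
      exact Nat.mul_dvd_mul_left b hn
    · rintro ⟨q, rfl⟩
      rw [mul_assoc, h.pow_mul_apply_eq hu, hdiv]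
      exact dvd_mul_right _ _
  exact Nat.dvd_antisymm ((v.pow_apply_eq_self_iff_dvd _ _).1 ((key _).2 dvd_rfl))
    ((key _).1 ((v.pow_apply_eq_self_iff_dvd _ _).2 dvd_rfl))

theorem Commute.eq_of_sameCycle_pow (h : Commute g v)
    (hb : ∀ n : ℕ, g.SameCycle x₀ ((v ^ n) x₀) ↔ b ∣ n) (hu : (v ^ b) x₀ = (g ^ u) x₀)
    {s t : ℕ} (hs : s < u.gcd (minimalPeriod g x₀)) (ht : t < u.gcd (minimalPeriod g x₀))
    (hst : v.SameCycle ((g ^ s) x₀) ((g ^ t) x₀)) : s = t := by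
  wlog hle : s ≤ t generalizing s t
  · exact (this ht hs hst.symm (le_of_not_ge hle)).symm
  obtain ⟨n, hn⟩ := hst.exists_nat_pow_eq
  obtain ⟨k, rfl⟩ := Nat.exists_eq_add_of_le hle
  rw [← h.pow_apply_pow_apply, pow_add, Perm.mul_apply, (g ^ s).injective.eq_iff] at hn
  obtain ⟨n', rfl⟩ := (hb n).1 (by rw [hn]; exact Perm.SameCycle.rfl.pow_right)
  rw [h.pow_mul_apply_eq hu, g.pow_apply_eq_pow_apply_iff] at hn
  have hk : u.gcd (minimalPeriod g x₀) ∣ k :=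
    (hn.dvd_iff (Nat.gcd_dvd_right _ _)).1 (dvd_mul_of_dvd_left (Nat.gcd_dvd_left _ _) _)
  have := Nat.eq_zero_of_dvd_of_lt hk (by omega)
  omega

omit [Fintype α] in
theorem Commute.pow_gcd_apply_eq (h : Commute g v) (hu : (v ^ b) x₀ = (g ^ u) x₀)
    (hm : u * m ≡ u.gcd (minimalPeriod g x₀) [MOD minimalPeriod g x₀]) :
    (g ^ u.gcd (minimalPeriod g x₀)) x₀ = (v ^ (b * m)) x₀ := by
  rw [h.pow_mul_apply_eq hu, g.pow_apply_eq_pow_apply_iff]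
  exact hm.symm

theorem Commute.exists_sameCycle_pow_lt (h : Commute g v) (hu : (v ^ b) x₀ = (g ^ u) x₀)
    (hm : u * m ≡ u.gcd (minimalPeriod g x₀) [MOD minimalPeriod g x₀]) (k : ℕ) :
    ∃ t < u.gcd (minimalPeriod g x₀), v.SameCycle ((g ^ k) x₀) ((g ^ t) x₀) := by
  have hj := Nat.gcd_pos_of_pos_right u (g.minimalPeriod_pos x₀)
  have hstep : v.SameCycle ((g ^ u.gcd (minimalPeriod g x₀)) x₀) x₀ := by
    rw [h.pow_gcd_apply_eq hu hm]
    exact Perm.SameCycle.rfl.pow_left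
  refine ⟨k % u.gcd (minimalPeriod g x₀), Nat.mod_lt _ hj, ?_⟩
  have key : ∀ q t : ℕ, v.SameCycle ((g ^ (t + u.gcd (minimalPeriod g x₀) * q)) x₀)
      ((g ^ t) x₀) := by
    intro q t
    induction q with
    | zero => exact Perm.SameCycle.rfl
    | succ q ih =>
      rw [Nat.mul_succ, ← add_assoc, pow_add, Perm.mul_apply]
      exact ((h.symm.sameCycle_pow _).2 hstep).trans ih
  have := key (k / u.gcd (minimalPeriod g x₀)) (k % u.gcd (minimalPeriod g x₀))
  rwa [Nat.mod_add_div] at this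

theorem Commute.cyclePhase_pow_gcd (h : Commute g v) (hb0 : b ≠ 0)
    (hb : ∀ n : ℕ, g.SameCycle x₀ ((v ^ n) x₀) ↔ b ∣ n) (hu : (v ^ b) x₀ = (g ^ u) x₀)
    (hm : u * m ≡ u.gcd (minimalPeriod g x₀) [MOD minimalPeriod g x₀]) :
    cyclePhase v x₀ ((g ^ u.gcd (minimalPeriod g x₀)) x₀) =
      rootExp (m * u.gcd (minimalPeriod g x₀)) (minimalPeriod g x₀) := by
  have hj := Nat.gcd_pos_of_pos_right u (g.minimalPeriod_pos x₀)
  rw [h.pow_gcd_apply_eq hu hm, cyclePhase_pow_apply, h.minimalPeriod_eq hb hu,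
    rootExp_mul_left hb0, mul_comm m, ← rootExp_mul_left hj.ne',
    Nat.mul_div_cancel' (Nat.gcd_dvd_right _ _)]

/-- On the block `P`, `v` has j = gcd(u, d) cycles, cyclically permuted by `g`. Their contribution
is the phase of g^j x₀ = v^(bm) x₀ in a cycle of length bd/j, that is exp(2πi mj/d). Off the block
`v` may be replaced by `w`. -/
theorem Commute.conjCocycle_eq_of_agree (h : Commute g v) (hgw : Commute g w) (hb0 : b ≠ 0)
    (hb : ∀ n : ℕ, g.SameCycle x₀ ((v ^ n) x₀) ↔ b ∣ n) (hu : (v ^ b) x₀ = (g ^ u) x₀)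
    (hm : u * m ≡ u.gcd (minimalPeriod g x₀) [MOD minimalPeriod g x₀])
    (P : α → Prop) [DecidablePred P] (hPx : P x₀) (hPg : ∀ y, P (g y) ↔ P y)
    (hPw : ∀ y, P (w y) ↔ P y)
    (hvw : ∀ y, ¬ P y → v y = w y) (hPv : ∀ y, P y → ∃ s k : ℕ, (v ^ s) ((g ^ k) x₀) = y) :
    conjCocycle g v = (∏ t ∈ cycleBases w with ¬ P t, phaseRatio g w t) *
      rootExp (m * u.gcd (minimalPeriod g x₀)) (minimalPeriod g x₀) := by
  classical
  have hPwn : ∀ (n : ℕ) y, P ((w ^ n) y) ↔ P y := by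
    intro n
    induction n with
    | zero => simp
    | succ n ih => intro y; rw [pow_succ', Perm.mul_apply, hPw, ih]
  have hPgn : ∀ (n : ℕ) y, P ((g ^ n) y) ↔ P y := by
    intro n
    induction n with
    | zero => simp
    | succ n ih => intro y; rw [pow_succ', Perm.mul_apply, hPg, ih]
  have hvwn : ∀ (n : ℕ) y, ¬ P y → (v ^ n) y = (w ^ n) y := by
    intro n y hy
    induction n with
    | zero => rfl
    | succ n ih =>
      rw [pow_succ', Perm.mul_apply, ih, hvw _ (by rwa [hPwn]), pow_succ', Perm.mul_apply]
  have hsame : ∀ y z, ¬ P y → v.SameCycle y z → w.SameCycle y z := by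
    intro y z hy hyz
    obtain ⟨n, rfl⟩ := hyz.exists_nat_pow_eq
    rw [hvwn n y hy]
    exact Perm.SameCycle.rfl.pow_right
  have hsame' : ∀ y z, ¬ P y → w.SameCycle y z → v.SameCycle y z ∧ ¬ P z := by
    intro y z hy hyz
    obtain ⟨n, rfl⟩ := hyz.exists_nat_pow_eq
    refine ⟨?_, by rwa [hPwn]⟩
    rw [← hvwn n y hy]
    exact Perm.SameCycle.rfl.pow_right
  have hinj : Set.InjOn (fun t : ℕ => (g ^ t) x₀) (Finset.range (u.gcd (minimalPeriod g x₀))) := by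
    intro s hs t ht hst
    rw [Finset.coe_range, Set.mem_Iio] at hs ht
    exact h.eq_of_sameCycle_pow hb hu hs ht (hst.sameCycle v)
  have hT : IsCycleTransversal v ((cycleBases w).filter (fun t => ¬ P t) ∪
      (Finset.range (u.gcd (minimalPeriod g x₀))).image fun t => (g ^ t) x₀) := by
    refine ⟨fun x => ?_, fun s hs t ht hst => ?_⟩
    · by_cases hx : P x
      · obtain ⟨s, k, rfl⟩ := hPv x hx
        obtain ⟨t, ht, hkt⟩ := h.exists_sameCycle_pow_lt hu hm k
        exact ⟨_, Finset.mem_union_right _ (Finset.mem_image_of_mem _ (Finset.mem_range.2 ht)),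
          hkt.pow_left⟩
      · obtain ⟨t, ht, hxt⟩ := (isCycleTransversal_cycleBases w).exists_mem x
        obtain ⟨h1, h2⟩ := hsame' x t hx hxt
        exact ⟨t, Finset.mem_union_left _ (Finset.mem_filter.2 ⟨ht, h2⟩), h1⟩
    · simp only [Finset.mem_union, Finset.mem_filter, Finset.mem_image, Finset.mem_range] at hs ht
      rcases hs with ⟨hs, hsP⟩ | ⟨s, hs, rfl⟩
      · have hst' := hsame s t hsP hst
        rcases ht with ⟨ht, -⟩ | ⟨t, ht, rfl⟩
        · exact (isCycleTransversal_cycleBases w).eq_of_sameCycle s hs t ht hst'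
        · exact ((hsame' _ _ hsP hst').2 ((hPgn t x₀).2 hPx)).elim
      · rcases ht with ⟨ht, htP⟩ | ⟨t, ht, rfl⟩
        · exact ((hsame' _ _ htP (hsame _ _ htP hst.symm)).2 ((hPgn s x₀).2 hPx)).elim
        · rw [h.eq_of_sameCycle_pow hb hu hs ht hst]
  have hdisj : Disjoint ((cycleBases w).filter (fun t => ¬ P t))
      ((Finset.range (u.gcd (minimalPeriod g x₀))).image fun t => (g ^ t) x₀) := by
    rw [Finset.disjoint_left]
    intro y hy hy'
    obtain ⟨t, -, rfl⟩ := Finset.mem_image.1 hy'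
    exact (Finset.mem_filter.1 hy).2 ((hPgn t x₀).2 hPx)
  have hv1 : g * v * g⁻¹ = v := by rw [h.eq, mul_inv_cancel_right]
  have hw1 : g * w * g⁻¹ = w := by rw [hgw.eq, mul_inv_cancel_right]
  rw [hT.conjCocycle_eq, Finset.prod_union hdisj, Finset.prod_image hinj,
    ← h.cyclePhase_pow_gcd hb0 hb hu hm]
  congr 1
  · refine Finset.prod_congr rfl fun t ht => ?_
    have htP := (Finset.mem_filter.1 ht).2
    rw [phaseRatio, phaseRatio, hv1, hw1, basePhase_congr fun n => hvwn n t htP,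
      basePhase_congr fun n => hvwn n (g t) (by rwa [hPg])]
  · have hsc : v.SameCycle x₀ ((g ^ u.gcd (minimalPeriod g x₀)) x₀) := by
      rw [h.pow_gcd_apply_eq hu hm]
      exact Perm.SameCycle.rfl.pow_right
    have : ∀ t : ℕ, phaseRatio g v ((g ^ t) x₀) =
        basePhase v ((g ^ (t + 1)) x₀) / basePhase v ((g ^ t) x₀) := fun t => by
      rw [phaseRatio, hv1, ← Perm.mul_apply, pow_succ']
    simp only [this]
    -- The ratios telescope along x₀, g x₀, g² x₀, ....
    have hprod : ∀ k : ℕ, ∏ t ∈ Finset.range k,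
        basePhase v ((g ^ (t + 1)) x₀) / basePhase v ((g ^ t) x₀) =
          basePhase v ((g ^ k) x₀) / basePhase v x₀ := by
      intro k
      induction k with
      | zero => simp [basePhase_ne_zero]
      | succ k ih =>
        rw [Finset.prod_range_succ, ih, mul_comm, div_mul_div_cancel₀ (basePhase_ne_zero _ _)]
    rw [hprod, ← basePhase_mul_cyclePhase hsc, mul_div_cancel_left₀ _ (basePhase_ne_zero _ _)]

end CommutingPair

/-! ### Translation by powers of a cycle of `g` -/

section CycleTranslation

variable {α : Type*} [Fintype α] [DecidableEq α] {g w : Perm α}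

omit [Fintype α] [DecidableEq α] in
theorem Equiv.Perm.exists_pow_apply_apply_eq [Finite α] (w : Perm α) (y : α) :
    ∃ n : ℕ, (w ^ n) (w y) = y :=
  ⟨orderOf w - 1, by
    rw [← Perm.mul_apply, ← pow_succ, Nat.sub_add_cancel (orderOf_pos w), pow_orderOf_eq_one,
      Perm.one_apply]⟩

theorem Equiv.Perm.cycleOf_pow_apply_of_sameCycle {x y : α} (h : g.SameCycle x y) (i : ℕ) :
    (g.cycleOf x ^ i) y = (g ^ i) y := by
  rw [h.cycleOf_eq, Perm.cycleOf_pow_apply_self]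

theorem Equiv.Perm.cycleOf_pow_apply_of_not_sameCycle {x y : α} (h : ¬ g.SameCycle x y) (i : ℕ) :
    (g.cycleOf x ^ i) y = y :=
  IsFixedPt.perm_pow (e := g.cycleOf x) (Perm.cycleOf_apply_of_not_sameCycle h) i

theorem Equiv.Perm.commute_cycleOf_pow (g : Perm α) (x : α) (i : ℕ) :
    Commute g (g.cycleOf x ^ i) := by
  ext y
  rw [Perm.mul_apply, Perm.mul_apply]
  by_cases h : g.SameCycle x y
  · rw [cycleOf_pow_apply_of_sameCycle h, cycleOf_pow_apply_of_sameCycle h.apply_right,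
      ← Perm.mul_apply, ← Perm.mul_apply, pow_mul_comm']
  · rw [cycleOf_pow_apply_of_not_sameCycle h,
      cycleOf_pow_apply_of_not_sameCycle (by rwa [Perm.sameCycle_apply_right])]

theorem Equiv.Perm.sameCycle_cycleOf_pow_apply (g : Perm α) (x : α) (i : ℕ) (y : α) :
    g.SameCycle y ((g.cycleOf x ^ i) y) := by
  by_cases h : g.SameCycle x y
  · rw [cycleOf_pow_apply_of_sameCycle h]
    exact Perm.SameCycle.rfl.pow_right
  · rw [cycleOf_pow_apply_of_not_sameCycle h]

/-- Multiplying by the `i`-th power of the cycle only shifts the first-return rotation from `c` to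
`c + i`. The factor `A` comes from outside the block and does not see `i`. -/
theorem Commute.exists_conjCocycle_mul_cycleOf_pow (h : Commute g w) (x₀ : α) :
    ∃ (A : ℂ) (c : ℕ), ∀ i m : ℕ,
      (c + i) * m ≡ (c + i).gcd (minimalPeriod g x₀) [MOD minimalPeriod g x₀] →
      conjCocycle g (w * g.cycleOf x₀ ^ i) =
        A * rootExp (m * (c + i).gcd (minimalPeriod g x₀)) (minimalPeriod g x₀) := by
  classical
  obtain ⟨b, hb0, hb⟩ := h.exists_sameCycle_pow_iff_dvd x₀
  obtain ⟨c, hc⟩ := ((hb b).2 dvd_rfl).exists_nat_pow_eq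
  -- The orbit of `x₀` under the group generated by `g` and `w`.
  let P : α → Prop := fun y => ∃ s k : ℕ, (w ^ s) ((g ^ k) x₀) = y
  refine ⟨∏ t ∈ cycleBases w with ¬ P t, phaseRatio g w t, c, fun i m hm => ?_⟩
  have hcomm : Commute g (w * g.cycleOf x₀ ^ i) := h.mul_right (g.commute_cycleOf_pow x₀ i)
  have hv : ∀ (n : ℕ) (y : α),
      g.SameCycle ((w ^ n) y) (((w * g.cycleOf x₀ ^ i) ^ n) y) := by
    intro n y
    induction n with
    | zero => exact Perm.SameCycle.rfl
    | succ n ih =>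
      rw [pow_succ', pow_succ', Perm.mul_apply, Perm.mul_apply, Perm.mul_apply]
      have := ih.trans (g.sameCycle_cycleOf_pow_apply x₀ i _)
      simpa using (h.sameCycle_pow 1).2 this
  -- Before time `b` the path stays off the `g`-cycle of `x₀`, so the extra rotation acts only at
  -- the first step.
  have hret : ∀ s : ℕ, s < b →
      ((w * g.cycleOf x₀ ^ i) ^ (s + 1)) x₀ = (w ^ (s + 1)) ((g ^ i) x₀) := by
    intro s hs
    induction s with
    | zero => simp [Perm.cycleOf_pow_apply_self]
    | succ s ih =>
      rw [pow_succ', Perm.mul_apply, ih (by omega), Perm.mul_apply,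
        Perm.cycleOf_pow_apply_of_not_sameCycle, ← Perm.mul_apply, ← pow_succ']
      rw [← h.pow_apply_pow_apply, Perm.sameCycle_pow_right, hb]
      exact fun hd => absurd (Nat.le_of_dvd (Nat.succ_pos s) hd) (by omega)
  have hvb : ((w * g.cycleOf x₀ ^ i) ^ b) x₀ = (g ^ (c + i)) x₀ := by
    have := hret (b - 1) (by omega)
    rw [Nat.sub_add_cancel hb0] at this
    rw [this, ← h.pow_apply_pow_apply, ← hc, ← Perm.mul_apply, ← pow_add, add_comm]
  refine hcomm.conjCocycle_eq_of_agree h hb0.ne'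
    (fun n => ⟨fun hn => (hb n).1 (hn.trans (hv n x₀).symm), fun hn => ((hb n).2 hn).trans (hv n x₀)⟩)
    hvb hm P ⟨0, 0, rfl⟩ ?_ ?_ ?_ ?_
  · refine fun y => ⟨fun ⟨s, k, hy⟩ => ?_, fun ⟨s, k, hy⟩ => ⟨s, k + 1, ?_⟩⟩
    · obtain ⟨n, hn⟩ := g.exists_pow_apply_apply_eq y
      refine ⟨s, n + k, ?_⟩
      rw [pow_add, Perm.mul_apply, ← h.pow_apply_pow_apply, hy, hn]
    · rw [pow_succ', Perm.mul_apply, ← hy]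
      simpa using (h.pow_apply_pow_apply 1 s ((g ^ k) x₀)).symm
  · refine fun y => ⟨fun ⟨s, k, hy⟩ => ?_, fun ⟨s, k, hy⟩ => ⟨s + 1, k, ?_⟩⟩
    · obtain ⟨n, hn⟩ := w.exists_pow_apply_apply_eq y
      exact ⟨n + s, k, by rw [pow_add, Perm.mul_apply, hy, hn]⟩
    · rw [pow_succ', Perm.mul_apply, hy]
  · intro y hy
    rw [Perm.mul_apply, Perm.cycleOf_pow_apply_of_not_sameCycle]
    intro hxy
    obtain ⟨k, hk⟩ := hxy.exists_nat_pow_eq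
    exact hy ⟨0, k, hk⟩
  · have hz : ∀ y, (g.cycleOf x₀ ^ i) ((g.cycleOf x₀ ^ i)⁻¹ y) = y := fun y => by
      rw [← Perm.mul_apply, mul_inv_cancel, Perm.one_apply]
    rintro y ⟨s, k, rfl⟩
    induction s with
    | zero => exact ⟨0, k, rfl⟩
    | succ s ih =>
      obtain ⟨s', k', hy⟩ := ih
      rw [pow_succ', Perm.mul_apply, ← hy]
      have hsc := g.sameCycle_cycleOf_pow_apply x₀ i
        ((g.cycleOf x₀ ^ i)⁻¹ (((w * g.cycleOf x₀ ^ i) ^ s') ((g ^ k') x₀)))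
      rw [hz] at hsc
      obtain ⟨n, hn⟩ := hsc.symm.exists_nat_pow_eq
      refine ⟨s' + 1, n + k', ?_⟩
      rw [pow_succ', Perm.mul_apply, pow_add g, Perm.mul_apply (g ^ n),
        ← hcomm.pow_apply_pow_apply n s' ((g ^ k') x₀), hn, Perm.mul_apply, hz]

-- Right translation by powers of a cycle of `g` preserves the centralizer of `g`; averaging over
-- these translations kills the sum.
open Classical in
theorem sum_conjCocycle_pow_eq_zero {r : ℕ} (hr : g ^ r ≠ 1) :
    ∑ w : Perm α with Commute g w, conjCocycle g w ^ r = 0 := by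
  obtain ⟨x₀, hx₀⟩ : ∃ x, (g ^ r) x ≠ x := by
    by_contra! hc
    exact hr (Perm.ext hc)
  rw [ne_eq, g.pow_apply_eq_self_iff_dvd] at hx₀
  have hd := g.minimalPeriod_pos x₀
  have h1 : ∀ i : ℕ, ∑ w : Perm α with Commute g w, conjCocycle g (w * g.cycleOf x₀ ^ i) ^ r =
      ∑ w : Perm α with Commute g w, conjCocycle g w ^ r := by
    intro i
    have hz := g.commute_cycleOf_pow x₀ i
    refine Finset.sum_bij' (fun w _ => w * g.cycleOf x₀ ^ i) (fun w _ => w * (g.cycleOf x₀ ^ i)⁻¹)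
      ?_ ?_ ?_ ?_ ?_
    · exact fun w hw => by simpa using (Finset.mem_filter.1 hw).2.mul_right hz
    · exact fun w hw => by simpa using (Finset.mem_filter.1 hw).2.mul_right hz.inv_right
    · simp
    · simp
    · simp
  have h2 : ∀ w : Perm α, Commute g w →
      ∑ i ∈ Finset.range (minimalPeriod g x₀), conjCocycle g (w * g.cycleOf x₀ ^ i) ^ r = 0 := by
    intro w hw
    obtain ⟨A, c, hA⟩ := hw.exists_conjCocycle_mul_cycleOf_pow x₀
    choose m hm using fun i => exists_mul_modEq_gcd hd (c + i)
    simp only [hA _ _ (hm _), mul_pow]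
    rw [← Finset.mul_sum, sum_rootExp_pow_eq_zero hd hx₀ c m hm, mul_zero]
  have h3 : (minimalPeriod g x₀ : ℂ) * ∑ w : Perm α with Commute g w, conjCocycle g w ^ r = 0 := by
    rw [← nsmul_eq_mul, ← Finset.card_range (minimalPeriod g x₀), ← Finset.sum_const,
      ← Finset.sum_congr rfl fun i _ => h1 i, Finset.sum_comm]
    exact Finset.sum_eq_zero fun w hw => h2 w (Finset.mem_filter.1 hw).2
  exact (mul_eq_zero.1 h3).resolve_left (Nat.cast_ne_zero.2 hd.ne')

open Classical in
theorem sum_conjCocycle_pow_eq_card {r : ℕ} (hr : g ^ r = 1) :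
    ∑ w : Perm α with Commute g w, conjCocycle g w ^ r =
      (Finset.card {w : Perm α | Commute g w} : ℂ) := by
  rw [Finset.cast_card]
  refine Finset.sum_congr rfl fun w hw => ?_
  rw [← conjCocycle_pow (Finset.mem_filter.1 hw).2, hr, conjCocycle_one]

end CycleTranslation

/-! ### The twisted conjugation representation -/

/-- The conjugation representation of the symmetric group twisted by the `r`-th power of
`conjCocycle`. -/
noncomputable def twistedConjRep (α : Type*) [Fintype α] (r : ℕ) :
    Representation ℂ (Perm α) (Perm α → ℂ) where
  -- The indicator of `w` goes to c(g, w)^r times that of gwg⁻¹.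
  toFun g :=
    { toFun := fun f w => conjCocycle g (g⁻¹ * w * g) ^ r * f (g⁻¹ * w * g)
      map_add' := fun f f' => by ext w; simp [mul_add]
      map_smul' := fun a f => by ext w; simp [mul_left_comm] }
  map_one' := by ext f w; simp [conjCocycle_one]
  map_mul' g h := by
    ext f w
    simp only [LinearMap.coe_mk, AddHom.coe_mk, Module.End.mul_apply]
    rw [conjCocycle_mul, mul_pow, mul_assoc]
    simp [mul_assoc]

open Classical in
theorem twistedConjRep_character {α : Type*} [Fintype α] [DecidableEq α] (r : ℕ) (g : Perm α) :
    (twistedConjRep α r).character g = ∑ w : Perm α with Commute g w, conjCocycle g w ^ r := by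
  rw [Representation.character, LinearMap.trace_eq_matrix_trace ℂ (Pi.basisFun ℂ (Perm α)),
    Matrix.trace, Finset.sum_filter]
  refine Finset.sum_congr rfl fun w _ => ?_
  have hiff : g⁻¹ * w * g = w ↔ Commute g w := by
    rw [mul_assoc, inv_mul_eq_iff_eq_mul]
    exact ⟨fun h => h.symm, fun h => Eq.symm h⟩
  by_cases hw : Commute g w
  · have := hiff.2 hw
    simp [twistedConjRep, this, hw]
  · have : g⁻¹ * w * g ≠ w := fun h => hw (hiff.1 h)
    simp [twistedConjRep, this, hw]

open Classical in
theorem twistedConjRep_character_eq_ite {α : Type*} [Fintype α] [DecidableEq α] (r : ℕ)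
    (g : Perm α) : (twistedConjRep α r).character g =
      if g ^ r = 1 then (Finset.card {w : Perm α | Commute g w} : ℂ) else 0 := by
  rw [twistedConjRep_character]
  split_ifs with h
  · exact sum_conjCocycle_pow_eq_card h
  · exact sum_conjCocycle_pow_eq_zero h

/-! ### Cycle types and centralizer orders -/

section CycleType

variable {α : Type*} [Fintype α] [DecidableEq α]

theorem Nat.Partition.exists_perm_partition_eq (lam : (Fintype.card α).Partition) :
    ∃ w : Perm α, w.partition = lam := by
  have hsum : (lam.parts.filter fun n => 2 ≤ n).sum ≤ Fintype.card α := by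
    conv_rhs => rw [← lam.parts_sum, ← Multiset.filter_add_not (fun n => 2 ≤ n) lam.parts,
      Multiset.sum_add]
    exact Nat.le_add_right _ _
  obtain ⟨w, hw⟩ := (Perm.exists_with_cycleType_iff α).2
    ⟨hsum, fun a ha => (Multiset.mem_filter.1 ha).2⟩
  refine ⟨w, Nat.Partition.ext ?_⟩
  rw [Perm.parts_partition, ← Perm.sum_cycleType, hw]
  conv_rhs => rw [← Multiset.filter_add_not (fun n => 2 ≤ n) lam.parts]
  congr 1
  have hone : ∀ b ∈ lam.parts.filter (fun n => ¬ 2 ≤ n), b = 1 := fun b hb => by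
    have h1 := (Multiset.mem_filter.1 hb).2
    have h2 := lam.parts_pos (Multiset.mem_filter.1 hb).1
    omega
  have hrep := Multiset.eq_replicate_card.2 hone
  have htot : (lam.parts.filter fun n => 2 ≤ n).sum +
      (lam.parts.filter fun n => ¬ 2 ≤ n).card = Fintype.card α := by
    conv_rhs => rw [← lam.parts_sum, ← Multiset.filter_add_not (fun n => 2 ≤ n) lam.parts,
      Multiset.sum_add, hrep]
    simp
  rw [hrep]
  congr 1
  omega

theorem Equiv.Perm.pow_eq_one_iff_forall_parts_dvd (w : Perm α) (r : ℕ) :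
    w ^ r = 1 ↔ ∀ i ∈ w.partition.parts, i ∣ r := by
  rw [← orderOf_dvd_iff_pow_eq_one, ← Perm.lcm_cycleType, Multiset.lcm_dvd, Perm.parts_partition]
  refine ⟨fun h i hi => ?_, fun h i hi => h i (Multiset.mem_add.2 (Or.inl hi))⟩
  rcases Multiset.mem_add.1 hi with hi | hi
  · exact h i hi
  · rw [Multiset.eq_of_mem_replicate hi]
    exact one_dvd r

-- Orbit-stabilizer: permutations of one type form a conjugacy class with constant centralizer
-- order.
open Classical in
theorem sum_card_commute_of_partition_eq (lam : (Fintype.card α).Partition) :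
    ∑ w : Perm α with w.partition = lam, Finset.card {v : Perm α | Commute w v} =
      (Fintype.card α)! := by
  obtain ⟨w₀, rfl⟩ := lam.exists_perm_partition_eq
  have hcard : ∀ w : Perm α, Finset.card {v : Perm α | Commute w v} =
      Nat.card (Subgroup.centralizer {w}) := fun w => by
    rw [← Fintype.card_subtype, ← Nat.card_eq_fintype_card]
    refine Nat.card_congr (Equiv.subtypeEquivRight fun v => ?_)
    rw [Subgroup.mem_centralizer_singleton_iff]
    exact ⟨fun h => Eq.symm h, fun h => Eq.symm h⟩
  have hconst : ∀ w ∈ ({w | w.partition = w₀.partition} : Finset (Perm α)),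
      Finset.card {v : Perm α | Commute w v} = Nat.card (Subgroup.centralizer {w₀}) := by
    intro w hw
    have hct : w.cycleType = w₀.cycleType :=
      Perm.isConj_iff_cycleType_eq.1 (Perm.partition_eq_of_isConj.2 (Finset.mem_filter.1 hw).2)
    rw [hcard, Perm.nat_card_centralizer, Perm.nat_card_centralizer, hct]
  rw [Finset.sum_congr rfl hconst, Finset.sum_const, smul_eq_mul, ← Perm.card_isConj_mul_eq w₀,
    Perm.nat_card_centralizer, ← Fintype.card_subtype, ← Nat.card_eq_fintype_card]
  congr 1
  refine Nat.card_congr (Equiv.subtypeEquivRight fun w => ?_)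
  rw [← Perm.partition_eq_of_isConj, isConj_comm]
  rfl

end CycleType

/-! ### Frobenius characteristics and the choice of `r` -/

theorem frobeniusChar_twistedConjRep (n r : ℕ) :
    frobeniusChar (twistedConjRep (Fin n) r) = powerSumSum n (fun i => i ∣ r) := by
  classical
  have hcast : powerSumSum n (fun i => i ∣ r) =
      powerSumSum (Fintype.card (Fin n)) (fun i => i ∣ r) := by rw [Fintype.card_fin]
  rw [hcast, frobeniusChar, powerSumSum, inv_smul_eq_iff₀ (Nat.cast_ne_zero.2 n.factorial_ne_zero),
    ← Finset.sum_fiberwise Finset.univ (fun w : Perm (Fin n) => w.partition), Finset.smul_sum,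
    Finset.sum_filter]
  refine Finset.sum_congr rfl fun lam _ => ?_
  have h1 : ∀ w ∈ ({w | w.partition = lam} : Finset (Perm (Fin n))),
      (twistedConjRep (Fin n) r).character w • powerSumPart w.partition =
        if ∀ i ∈ lam.parts, i ∣ r then
          (Finset.card {v : Perm (Fin n) | Commute w v} : ℂ) • powerSumPart lam else 0 := by
    intro w hw
    have hw' := (Finset.mem_filter.1 hw).2
    have hiff := w.pow_eq_one_iff_forall_parts_dvd r
    rw [hw'] at hiff
    rw [twistedConjRep_character_eq_ite, hw']
    simp only [hiff, ite_smul, zero_smul]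
  rw [Finset.sum_congr rfl h1]
  split_ifs
  · rw [← Finset.sum_smul, ← Nat.cast_sum, sum_card_commute_of_partition_eq]
    congr 3
    exact Fintype.card_fin n
  · exact Finset.sum_const_zero

theorem powerSumSum_congr {n : ℕ} {P Q : ℕ → Prop}
    (h : ∀ i, 0 < i → i ≤ n → (P i ↔ Q i)) : powerSumSum n P = powerSumSum n Q := by
  classical
  rw [powerSumSum, powerSumSum]
  refine Finset.sum_congr (Finset.filter_congr fun lam _ => ?_) fun _ _ => rfl
  exact forall₂_congr fun i hi =>
    h i (lam.parts_pos hi) ((Multiset.le_sum_of_mem hi).trans_eq lam.parts_sum)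

theorem finrank_perm_fun (n : ℕ) : Module.finrank ℂ (Perm (Fin n) → ℂ) = n ! := by
  rw [Module.finrank_fintype_fun_eq_card, Fintype.card_perm, Fintype.card_fin]

theorem isSelfConjugate_twistedConjRep (n : ℕ) {r : ℕ} (hr : Odd r) :
    IsSelfConjugate (twistedConjRep (Fin n) r) := by
  classical
  refine nonempty_equiv_of_character_eq _ _ ?_
  rw [Representation.char_tensor]
  ext g
  have hsign : (signRep n).character g = ((Perm.sign g : ℤ) : ℂ) := by
    simp [Representation.character, signRep]
  rw [Pi.mul_apply, hsign, twistedConjRep_character_eq_ite]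
  split_ifs with hg
  -- For odd `r`, the support g^r = 1 contains only even permutations.
  · have h1 : Perm.sign g ^ r = 1 := by rw [← map_pow, hg, map_one]
    have h2 : Perm.sign g = 1 := by
      rcases Int.units_eq_one_or (Perm.sign g) with h | h
      · exact h
      · rw [h, hr.neg_one_pow] at h1
        exact absurd h1 (by decide)
    rw [h2]
    simp
  · rw [zero_mul]

theorem dvd_ordCompl_factorial_iff {q : ℕ} (hq : q.Prime) {i n : ℕ} (hi : 0 < i) (hin : i ≤ n) :
    i ∣ ordCompl[q] n ! ↔ i.Coprime q := by
  refine ⟨fun h => ((Nat.coprime_ordCompl hq n.factorial_ne_zero).coprime_dvd_right h).symm,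
    fun h => ?_⟩
  have h1 : i ∣ ordProj[q] n ! * ordCompl[q] n ! := by
    rw [Nat.ordProj_mul_ordCompl_eq_self]
    exact Nat.dvd_factorial hi hin
  exact (h.pow_right _).dvd_of_dvd_mul_left h1

theorem mainTheorem10 (q : ℕ) (hq : q.Prime) (n : ℕ) :
    (∃ (V : Type) (_ : AddCommGroup V) (_ : Module ℂ V) (_ : FiniteDimensional ℂ V)
        (ρ : Representation ℂ (Equiv.Perm (Fin n)) V),
      frobeniusChar ρ = powerSumSum n (fun i => ∃ k : ℕ, i = q ^ k) ∧
      Module.finrank ℂ V = n ! ∧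
      (Odd q → IsSelfConjugate ρ)) ∧
    (∃ (V : Type) (_ : AddCommGroup V) (_ : Module ℂ V) (_ : FiniteDimensional ℂ V)
        (ρ : Representation ℂ (Equiv.Perm (Fin n)) V),
      frobeniusChar ρ = powerSumSum n (fun i => Nat.Coprime i q) ∧
      Module.finrank ℂ V = n !) ∧
    (Odd q →
      ∃ (V : Type) (_ : AddCommGroup V) (_ : Module ℂ V) (_ : FiniteDimensional ℂ V)
        (ρ : Representation ℂ (Equiv.Perm (Fin n)) V),
      frobeniusChar ρ = powerSumSum n (fun i => Odd i ∧ Nat.Coprime i q) ∧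
      Module.finrank ℂ V = n !) := by
  -- Only parts at most `n` matter: q^n is divisible by every power of `q` up to `n`, and the
  -- prime-to-`q` part of n! by every i ≤ n coprime to `q`; the gcd imposes oddness as well.
  refine ⟨⟨_, _, _, inferInstance, twistedConjRep (Fin n) (q ^ n), ?_, finrank_perm_fun n,
      fun hodd => isSelfConjugate_twistedConjRep n hodd.pow⟩,
    ⟨_, _, _, inferInstance, twistedConjRep (Fin n) (ordCompl[q] n !), ?_, finrank_perm_fun n⟩,
    fun _ => ⟨_, _, _, inferInstance,
      twistedConjRep (Fin n) ((ordCompl[2] n !).gcd (ordCompl[q] n !)), ?_, finrank_perm_fun n⟩⟩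
  · rw [frobeniusChar_twistedConjRep]
    refine powerSumSum_congr fun i _ hin => ⟨fun h => ?_, ?_⟩
    · obtain ⟨k, -, hk⟩ := (Nat.dvd_prime_pow hq).1 h
      exact ⟨k, hk⟩
    · rintro ⟨k, rfl⟩
      exact pow_dvd_pow q ((Nat.lt_pow_self hq.one_lt).le.trans hin)
  · rw [frobeniusChar_twistedConjRep]
    exact powerSumSum_congr fun i hi hin => dvd_ordCompl_factorial_iff hq hi hin
  · rw [frobeniusChar_twistedConjRep]
    refine powerSumSum_congr fun i hi hin => ?_
    rw [Nat.dvd_gcd_iff, dvd_ordCompl_factorial_iff Nat.prime_two hi hin,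
      dvd_ordCompl_factorial_iff hq hi hin, Nat.coprime_two_right]
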